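/- For integers $\ell,m\ge 0$ let $p_n(\ell,m)$, $0\le n\le \ell m$, denote the coefficients of the Gaussian ($q$-binomial) polynomial $$\binom{m+\ell}{m}_q=\frac{(q^{m+1}-1)\cdots(q^{m+\ell}-1)}{(q-1)\cdots(q^{\ell}-1)}=\sum_{n=0}^{\ell m}p_n(\ell,m)\,q^n .$$ Then for all integers $\ell,m\ge 8$ the following strict inequalities (and the middle equality) hold: $$p_1(\ell,m)<p_2(\ell,m)<\cdots<p_{\lfloor \ell m/2\rfloor}(\ell,m)=p_{\lceil \ell m/2\rceil}(\ell,m)>\cdots>p_{\ell m-2}(\ell,m)>p_{\ell m-1}(\ell,m).$$ -/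

import Mathlib

open Polynomial

/-- The numerator `(q^(m+1) - 1) ⋯ (q^(m+ℓ) - 1)`, as an integer polynomial in `q = X`. -/
noncomputable def qBinomialNum (ℓ m : ℕ) : ℤ[X] :=
  ∏ i ∈ Finset.Icc 1 ℓ, (X ^ (m + i) - 1)

/-- The denominator `(q - 1) ⋯ (q^ℓ - 1)`, a monic polynomial. -/
noncomputable def qBinomialDen (ℓ : ℕ) : ℤ[X] :=
  ∏ i ∈ Finset.Icc 1 ℓ, (X ^ i - 1)

/-- The `q`-binomial (Gaussian) coefficient `(m+ℓ choose m)_q`, the quotient of the two products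
above. The division by the monic denominator is exact, see `qBinomialDen_mul_qBinomial`. -/
noncomputable def qBinomial (ℓ m : ℕ) : ℤ[X] :=
  qBinomialNum ℓ m /ₘ qBinomialDen ℓ

/-- `p_n(ℓ, m)`, the coefficient of `q^n` in `(m+ℓ choose m)_q`. -/
noncomputable def qBinomialCoeff (ℓ m n : ℕ) : ℤ :=
  (qBinomial ℓ m).coeff n

theorem qBinomialDen_monic (ℓ : ℕ) : (qBinomialDen ℓ).Monic := by
  refine monic_prod_of_monic _ _ fun i hi => ?_
  have h := monic_X_pow_sub_C (1 : ℤ) (n := i) (by have := Finset.mem_Icc.mp hi; omega)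
  simpa using h

theorem qBinomialDen_dvd_num (ℓ m : ℕ) : qBinomialDen ℓ ∣ qBinomialNum ℓ m := by
  induction ℓ generalizing m with
  | zero => simp [qBinomialDen, qBinomialNum]
  | succ ℓ ihl =>
    induction m with
    | zero => simp [qBinomialDen, qBinomialNum]
    | succ m ihm =>
      have hd : qBinomialDen (ℓ + 1) = qBinomialDen ℓ * (X ^ (ℓ + 1) - 1) := by
        simp [qBinomialDen, Finset.prod_Icc_succ_top]
      have h1 : qBinomialNum (ℓ + 1) m = (X ^ (m + 1) - 1) * qBinomialNum ℓ (m + 1) := by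
        unfold qBinomialNum
        rw [← Finset.prod_Ioc_mul_eq_prod_Icc (by omega), mul_comm]
        congr 1
        refine (Finset.prod_bij (fun i _ => i + 1) ?_ ?_ ?_ ?_).symm
        · intro a ha
          simp only [Finset.mem_Icc, Finset.mem_Ioc] at *
          omega
        · intro a _ b _ h
          omega
        · intro b hb
          simp only [Finset.mem_Ioc] at hb
          exact ⟨b - 1, by simp only [Finset.mem_Icc]; omega, by omega⟩
        · intro a _
          congr 2
          omega
      have h2 : qBinomialNum (ℓ + 1) (m + 1) =
          X ^ (m + 1) * (qBinomialNum ℓ (m + 1) * (X ^ (ℓ + 1) - 1)) +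
            qBinomialNum (ℓ + 1) m := by
        rw [h1]
        simp only [qBinomialNum, Finset.prod_Icc_succ_top (show 1 ≤ ℓ + 1 by omega)]
        ring
      rw [h2]
      refine dvd_add (Dvd.dvd.mul_left ?_ _) ihm
      rw [hd]
      exact mul_dvd_mul_right (ihl _) _

/-- The division in the definition of `qBinomial` leaves no remainder. -/
theorem qBinomialDen_mul_qBinomial (ℓ m : ℕ) :
    qBinomialDen ℓ * qBinomial ℓ m = qBinomialNum ℓ m := by
  have h := modByMonic_add_div (qBinomialNum ℓ m) (qBinomialDen ℓ)
  rwa [(modByMonic_eq_zero_iff_dvd (qBinomialDen_monic ℓ)).mpr (qBinomialDen_dvd_num ℓ m),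
    zero_add] at h

/-! The idea is to read p_n(ℓ, m) as a dimension in a representation of sl₂. The polynomials of
degree m in x₀, …, x_ℓ carry an sl₂-action by derivations, and p_n(ℓ, m) is the dimension of the
space of index-weight n, since both satisfy the same Pascal recurrence
(`qBinomialCoeff_eq_weightCount`). Below the middle weight, lowering is surjective
(`exists_lowering_eq`), so p_n < p_{n+1} exactly when lowering kills some nonzero polynomial of
weight n + 1, a seminvariant.

Seminvariants multiply: a product of two is nonzero and killed by the derivation, and degrees and
weights add. Hence strict unimodality for (ℓ, m) and (ℓ, m') passes to (ℓ, m + m') under mild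
conditions (`IsStrictlyUnimodal.add`). Adding 8 repeatedly, in each variable by symmetry, reduces
everything to 8 ≤ ℓ, m ≤ 15, which is computed. -/

/-! ### Derivations and weighted homogeneity -/

namespace MvPolynomial

variable {σ R M : Type*} [CommSemiring R] [AddCommMonoid M]

/-- A derivation shifting the weight of every variable by `s` shifts every weight by `s`. -/
theorem IsWeightedHomogeneous.mkDerivation {M : Type*} [AddCommGroup M] {w : σ → M}
    {f : σ → MvPolynomial σ R} {s n : M}
    (hf : ∀ i, (f i).IsWeightedHomogeneous w (w i + s)) {p : MvPolynomial σ R}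
    (hp : p.IsWeightedHomogeneous w n) :
    (MvPolynomial.mkDerivation R f p).IsWeightedHomogeneous w (n + s) := by
  induction hp using IsWeightedHomogeneous.induction_on with
  | zero => simpa using isWeightedHomogeneous_zero R w _
  | add p q _ _ hp hq => simpa using hp.add hq
  | monomial d r hd =>
    rw [mkDerivation_monomial]
    refine (weightedHomogeneousSubmodule R w (n + s)).smul_mem r ?_
    refine IsWeightedHomogeneous.sum _ _ _ fun i hi => ?_
    have h := (isWeightedHomogeneous_monomial w (d - Finsupp.single i 1) ((d i : ℕ) : R) rfl).mul
      (hf i)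
    rw [← add_assoc, Finsupp.weight_sub_single_add (Finsupp.mem_support_iff.mp hi), hd] at h
    exact h

/-- Euler's identity for the derivation scaling each variable by an additive function of its
weight. -/
theorem IsWeightedHomogeneous.mkDerivation_smul_X {w : σ → M} (φ : M →+ R) {n : M}
    {p : MvPolynomial σ R} (hp : p.IsWeightedHomogeneous w n) :
    MvPolynomial.mkDerivation R (fun i => φ (w i) • (X i : MvPolynomial σ R)) p = φ n • p := by
  induction hp using IsWeightedHomogeneous.induction_on with
  | zero => simp
  | add p q _ _ hp hq => rw [map_add, hp, hq, smul_add]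
  | monomial d r hd =>
    rw [mkDerivation_monomial, ← hd, Finsupp.weight_apply, Finsupp.sum, Finsupp.sum, map_sum,
      Finset.sum_smul, Finset.smul_sum]
    refine Finset.sum_congr rfl fun i hi => ?_
    have h1 : d - Finsupp.single i 1 + Finsupp.single i 1 = d :=
      Finsupp.sub_add_single_one_cancel (Finsupp.mem_support_iff.mp hi)
    rw [smul_eq_mul, mul_smul_comm, X, monomial_mul, h1, map_nsmul, smul_monomial, smul_monomial,
      smul_monomial]
    congr 1
    simp only [smul_eq_mul, nsmul_eq_mul]
    ring

end MvPolynomial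

/-! ### The sl₂-action and surjectivity of lowering -/

/-- Degree and index-weight of the coefficients `x₀, …, x_ℓ` of the generic binary form. -/
def biweight (ℓ : ℕ) (i : Fin (ℓ + 1)) : ℤ × ℤ := (1, (i : ℤ))

/-- The derivation `xᵢ ↦ i xᵢ₋₁`. -/
noncomputable def lowering (ℓ : ℕ) :
    Derivation ℚ (MvPolynomial (Fin (ℓ + 1)) ℚ) (MvPolynomial (Fin (ℓ + 1)) ℚ) :=
  MvPolynomial.mkDerivation ℚ fun i =>
    (i : ℚ) • MvPolynomial.X ⟨(i : ℕ) - 1, by omega⟩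

/-- The derivation `xᵢ ↦ (ℓ - i) xᵢ₊₁`. -/
noncomputable def raising (ℓ : ℕ) :
    Derivation ℚ (MvPolynomial (Fin (ℓ + 1)) ℚ) (MvPolynomial (Fin (ℓ + 1)) ℚ) :=
  MvPolynomial.mkDerivation ℚ fun i =>
    ((ℓ : ℚ) - i) • MvPolynomial.X ⟨min ((i : ℕ) + 1) ℓ, by omega⟩

/-- The polynomials of degree `m` and index-weight `k` in `x₀, …, x_ℓ`. -/
noncomputable abbrev weightSpace (ℓ : ℕ) (m k : ℤ) : Submodule ℚ (MvPolynomial (Fin (ℓ + 1)) ℚ) :=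
  MvPolynomial.weightedHomogeneousSubmodule ℚ (biweight ℓ) (m, k)

/-- The linear functional giving the eigenvalue of the Cartan element. -/
def cartanWeight (ℓ : ℕ) : ℤ × ℤ →+ ℚ where
  toFun n := ℓ * n.1 - 2 * n.2
  map_zero' := by simp
  map_add' a b := by simp; ring

theorem lowering_mem {ℓ : ℕ} {m k k' : ℤ} (hk : k' + 1 = k) {p : MvPolynomial (Fin (ℓ + 1)) ℚ}
    (hp : p ∈ weightSpace ℓ m k) : lowering ℓ p ∈ weightSpace ℓ m k' := by
  have h := MvPolynomial.IsWeightedHomogeneous.mkDerivation (s := ((0 : ℤ), (-1 : ℤ)))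
    (f := fun i : Fin (ℓ + 1) =>
      (i : ℚ) • (MvPolynomial.X ⟨(i : ℕ) - 1, by omega⟩ : MvPolynomial (Fin (ℓ + 1)) ℚ)) ?_ hp
  · have e : ((m, k) : ℤ × ℤ) + (0, -1) = (m, k') := by ext <;> simp; omega
    rw [e] at h
    exact h
  · intro i
    rcases Nat.eq_zero_or_pos (i : ℕ) with h0 | h0
    · simpa [h0] using MvPolynomial.isWeightedHomogeneous_zero ℚ _ _
    · refine (MvPolynomial.weightedHomogeneousSubmodule ℚ _ _).smul_mem _ ?_
      have e : biweight ℓ i + (0, -1) = biweight ℓ ⟨(i : ℕ) - 1, by omega⟩ := by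
        ext <;> simp [biweight]; omega
      rw [e]
      exact MvPolynomial.isWeightedHomogeneous_X ℚ _ _

theorem raising_mem {ℓ : ℕ} {m k k' : ℤ} (hk : k + 1 = k') {p : MvPolynomial (Fin (ℓ + 1)) ℚ}
    (hp : p ∈ weightSpace ℓ m k) : raising ℓ p ∈ weightSpace ℓ m k' := by
  have h := MvPolynomial.IsWeightedHomogeneous.mkDerivation (s := ((0 : ℤ), (1 : ℤ)))
    (f := fun i : Fin (ℓ + 1) => ((ℓ : ℚ) - i) •
      (MvPolynomial.X ⟨min ((i : ℕ) + 1) ℓ, by omega⟩ : MvPolynomial (Fin (ℓ + 1)) ℚ)) ?_ hp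
  · have e : ((m, k) : ℤ × ℤ) + (0, 1) = (m, k') := by ext <;> simp; omega
    rw [e] at h
    exact h
  · intro i
    rcases Nat.eq_or_lt_of_le (Nat.le_of_lt_succ i.isLt) with h0 | h0
    · simpa [h0] using MvPolynomial.isWeightedHomogeneous_zero ℚ _ _
    · refine (MvPolynomial.weightedHomogeneousSubmodule ℚ _ _).smul_mem _ ?_
      have e : biweight ℓ i + (0, 1) = biweight ℓ ⟨min ((i : ℕ) + 1) ℓ, by omega⟩ := by
        ext <;> simp [biweight]; omega
      rw [e]
      exact MvPolynomial.isWeightedHomogeneous_X ℚ _ _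

/-- A commutator of derivations is determined on variables, where (ℓ - i)(i + 1) - i(ℓ - i + 1) = ℓ
- 2i. -/
theorem lie_lowering_raising (ℓ : ℕ) :
    ⁅lowering ℓ, raising ℓ⁆ = MvPolynomial.mkDerivation ℚ fun i =>
      cartanWeight ℓ (biweight ℓ i) • (MvPolynomial.X i : MvPolynomial (Fin (ℓ + 1)) ℚ) := by
  refine MvPolynomial.derivation_ext fun i => ?_
  rw [Derivation.commutator_apply]
  simp only [lowering, raising, MvPolynomial.mkDerivation_X, Derivation.map_smul, smul_smul]
  -- At the ends i = 0 and i = ℓ the truncated index is wrong, but its coefficient vanishes.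
  have h1 : ((ℓ : ℚ) - i) * ((min ((i : ℕ) + 1) ℓ : ℕ) : ℚ) = (ℓ - i) * (i + 1) := by
    rcases Nat.eq_or_lt_of_le (Nat.le_of_lt_succ i.isLt) with h0 | h0
    · simp [h0]
    · rw [min_eq_left (by omega)]; push_cast; ring
  have h2 : (i : ℚ) * ((ℓ : ℚ) - ((i : ℕ) - 1 : ℕ)) = i * (ℓ - i + 1) := by
    rcases Nat.eq_zero_or_pos (i : ℕ) with h0 | h0
    · simp [h0]
    · rw [Nat.cast_sub (by omega)]; push_cast; ring
  have h3 : ((ℓ : ℚ) - i) •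
      (MvPolynomial.X ⟨min ((i : ℕ) + 1) ℓ - 1, by omega⟩ : MvPolynomial (Fin (ℓ + 1)) ℚ) =
      ((ℓ : ℚ) - i) • MvPolynomial.X i := by
    rcases Nat.eq_or_lt_of_le (Nat.le_of_lt_succ i.isLt) with h0 | h0
    · simp [h0]
    · congr 2; ext; simp; omega
  have h4 : (i : ℚ) •
      (MvPolynomial.X ⟨min ((i : ℕ) - 1 + 1) ℓ, by omega⟩ : MvPolynomial (Fin (ℓ + 1)) ℚ) =
      (i : ℚ) • MvPolynomial.X i := by
    rcases Nat.eq_zero_or_pos (i : ℕ) with h0 | h0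
    · simp [h0]
    · congr 2; ext; simp; omega
  rw [h1, h2, mul_comm, mul_smul, h3, mul_comm (i : ℚ), mul_smul, h4, smul_smul, smul_smul,
    ← sub_smul]
  congr 1
  simp [cartanWeight, biweight]
  ring

theorem lowering_raising {ℓ : ℕ} {m k : ℤ} {p : MvPolynomial (Fin (ℓ + 1)) ℚ}
    (hp : p ∈ weightSpace ℓ m k) :
    lowering ℓ (raising ℓ p) = raising ℓ (lowering ℓ p) + ((ℓ * m - 2 * k : ℤ) : ℚ) • p := by
  have h := MvPolynomial.IsWeightedHomogeneous.mkDerivation_smul_X (cartanWeight ℓ) hp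
  rw [← lie_lowering_raising, Derivation.commutator_apply] at h
  rw [sub_eq_iff_eq_add'.mp h]
  simp [cartanWeight]

theorem raising_iterate_mem {ℓ : ℕ} {m k : ℤ} {p : MvPolynomial (Fin (ℓ + 1)) ℚ}
    (hp : p ∈ weightSpace ℓ m k) (j : ℕ) {k' : ℤ} (hk : k + j = k') :
    (raising ℓ)^[j] p ∈ weightSpace ℓ m k' := by
  induction j generalizing k' with
  | zero => simpa [← hk] using hp
  | succ j ih =>
    rw [Function.iterate_succ_apply']
    exact raising_mem (by push_cast at hk; omega) (ih rfl)

/-- The scalar is the sum of the Cartan eigenvalues ℓm - 2(k + i) over 0 ≤ i ≤ j. -/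
theorem lowering_raising_iterate {ℓ : ℕ} {m k : ℤ} {p : MvPolynomial (Fin (ℓ + 1)) ℚ}
    (hp : p ∈ weightSpace ℓ m k) (j : ℕ) :
    lowering ℓ ((raising ℓ)^[j + 1] p) = (raising ℓ)^[j + 1] (lowering ℓ p) +
      (((j + 1) * (ℓ * m - 2 * k - j) : ℤ) : ℚ) • (raising ℓ)^[j] p := by
  induction j with
  | zero => simpa using lowering_raising hp
  | succ j ih =>
    rw [Function.iterate_succ_apply', lowering_raising (raising_iterate_mem hp (j + 1) rfl), ih,
      map_add, Derivation.map_smul, ← Function.iterate_succ_apply' (raising ℓ),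
      ← Function.iterate_succ_apply' (raising ℓ), add_assoc, ← add_smul]
    congr 2
    push_cast
    ring

theorem weightSpace_eq_bot {ℓ : ℕ} {m k : ℤ} (hk : k < 0) : weightSpace ℓ m k = ⊥ := by
  rw [eq_bot_iff]
  intro p hp
  refine MvPolynomial.IsWeightedHomogeneous.eq_zero_of_no_monomials hp fun d hd => ?_
  have h := congrArg Prod.snd hd
  rw [Finsupp.weight_eq_sum, Prod.snd_sum] at h
  have : 0 ≤ ∑ i, (d i • biweight ℓ i).2 :=
    Finset.sum_nonneg fun i _ => by simp [biweight]; positivity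
  simp only at h
  omega

/-- Lowering p repeatedly ends in negative weight, where everything is 0; `n` bounds the remaining
steps. Going back, the commutation formula is solved for the j-th raising of p. -/
theorem exists_lowering_eq_raising_iterate {ℓ : ℕ} {m k : ℤ} (hk : 2 * k < ℓ * m) (n j : ℕ)
    (hn : k < j + n) {p : MvPolynomial (Fin (ℓ + 1)) ℚ} (hp : p ∈ weightSpace ℓ m (k - j)) :
    ∃ u ∈ weightSpace ℓ m (k + 1), lowering ℓ u = (raising ℓ)^[j] p := by
  induction n generalizing j p with
  | zero =>
    rw [weightSpace_eq_bot (by push_cast at hn; omega), Submodule.mem_bot] at hp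
    subst hp
    exact ⟨0, Submodule.zero_mem _, by simp [iterate_map_zero]⟩
  | succ n ih =>
    obtain ⟨u, hu, hu'⟩ := ih (j + 1) (by push_cast at hn ⊢; omega)
      (lowering_mem (k' := k - (j + 1 : ℕ)) (by push_cast; ring) hp)
    have h := lowering_raising_iterate hp j
    set c : ℚ := (((j + 1) * (ℓ * m - 2 * (k - j) - j) : ℤ) : ℚ) with hc
    have hc0 : c ≠ 0 := by
      rw [hc]
      -- The second factor is ℓm - 2k + j > 0; this is where being below the middle is used.
      exact_mod_cast mul_ne_zero (by omega) (by omega)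
    refine ⟨c⁻¹ • ((raising ℓ)^[j + 1] p - u), Submodule.smul_mem _ _ (Submodule.sub_mem _
      (raising_iterate_mem hp _ (by push_cast; ring)) hu), ?_⟩
    rw [Derivation.map_smul, map_sub, h, hu', add_sub_cancel_left, smul_smul, inv_mul_cancel₀ hc0,
      one_smul]

/-- Below the middle weight, the lowering operator is surjective. -/
theorem exists_lowering_eq {ℓ : ℕ} {m k : ℤ} (hk : 2 * k < ℓ * m)
    {p : MvPolynomial (Fin (ℓ + 1)) ℚ} (hp : p ∈ weightSpace ℓ m k) :
    ∃ u ∈ weightSpace ℓ m (k + 1), lowering ℓ u = p :=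
  exists_lowering_eq_raising_iterate hk (k.toNat + 1) 0 (by push_cast; omega) (by simpa using hp)

/-! ### Dimensions of weight spaces and seminvariants -/

/-- The number of monomials of degree `m` and index-weight `k` in `x₀, …, x_ℓ`. -/
noncomputable def weightCount (ℓ : ℕ) (m k : ℤ) : ℕ :=
  {d : Fin (ℓ + 1) →₀ ℕ | Finsupp.weight (biweight ℓ) d = (m, k)}.ncard

theorem weight_biweight_eq_iff {ℓ : ℕ} {m k : ℤ} (d : Fin (ℓ + 1) →₀ ℕ) :
    Finsupp.weight (biweight ℓ) d = (m, k) ↔ ∑ i, (d i : ℤ) = m ∧ ∑ i, (d i : ℤ) * i = k := by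
  simp [Finsupp.weight_eq_sum, Prod.ext_iff, Prod.fst_sum, Prod.snd_sum, biweight]

theorem finite_weight_biweight (ℓ : ℕ) (m k : ℤ) :
    {d : Fin (ℓ + 1) →₀ ℕ | Finsupp.weight (biweight ℓ) d = (m, k)}.Finite := by
  refine (Finsupp.finite_of_degree_eq m.toNat).subset fun d hd => ?_
  have h := ((weight_biweight_eq_iff d).mp hd).1
  rw [Set.mem_ofPred_eq, Finsupp.degree_eq_sum, ← h]
  exact_mod_cast (Int.toNat_natCast _).symm

instance finiteDimensional_weightSpace (ℓ : ℕ) (m k : ℤ) :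
    FiniteDimensional ℚ (weightSpace ℓ m k) := by
  have := (finite_weight_biweight ℓ m k).to_subtype
  rw [weightSpace, MvPolynomial.weightedHomogeneousSubmodule_eq_finsupp_supported]
  exact Module.Finite.of_basis (MvPolynomial.basisRestrictSupport ℚ _)

theorem finrank_weightSpace (ℓ : ℕ) (m k : ℤ) :
    Module.finrank ℚ (weightSpace ℓ m k) = weightCount ℓ m k := by
  rw [weightSpace, MvPolynomial.weightedHomogeneousSubmodule_eq_finsupp_supported]
  exact Module.finrank_eq_nat_card_basis (MvPolynomial.basisRestrictSupport ℚ _)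

/-- There is a nonzero seminvariant of degree `m` and weight `k` of binary forms of order `ℓ`. -/
def HasSeminvariant (ℓ : ℕ) (m k : ℤ) : Prop :=
  ∃ f ∈ weightSpace ℓ m k, f ≠ 0 ∧ lowering ℓ f = 0

theorem HasSeminvariant.add {ℓ : ℕ} {m m' k k' : ℤ} (h : HasSeminvariant ℓ m k)
    (h' : HasSeminvariant ℓ m' k') : HasSeminvariant ℓ (m + m') (k + k') := by
  obtain ⟨f, hf, hf0, hDf⟩ := h
  obtain ⟨g, hg, hg0, hDg⟩ := h'
  exact ⟨f * g, MvPolynomial.IsWeightedHomogeneous.mul hf hg, mul_ne_zero hf0 hg0, by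
    rw [Derivation.leibniz, hDf, hDg, smul_zero, smul_zero, add_zero]⟩

theorem hasSeminvariant_zero (ℓ m : ℕ) : HasSeminvariant ℓ m 0 := by
  refine ⟨MvPolynomial.X 0 ^ m, ?_, pow_ne_zero _ (MvPolynomial.X_ne_zero _), ?_⟩
  · have h := (MvPolynomial.isWeightedHomogeneous_X ℚ (biweight ℓ) 0).pow m
    simpa [biweight] using h
  · simp [Derivation.leibniz_pow, lowering]

/-- The lowering operator as a map between weight spaces. -/
noncomputable def loweringRestrict (ℓ : ℕ) (m k : ℤ) :
    weightSpace ℓ m (k + 1) →ₗ[ℚ] weightSpace ℓ m k :=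
  (lowering ℓ).toLinearMap.restrict fun _ hp => lowering_mem rfl hp

theorem hasSeminvariant_of_weightCount_lt {ℓ : ℕ} {m k : ℤ}
    (h : weightCount ℓ m k < weightCount ℓ m (k + 1)) : HasSeminvariant ℓ m (k + 1) := by
  rw [← finrank_weightSpace, ← finrank_weightSpace] at h
  obtain ⟨f, hf, hf0⟩ := (Submodule.ne_bot_iff _).mp
    (LinearMap.ker_ne_bot_of_finrank_lt (f := loweringRestrict ℓ m k) h)
  exact ⟨f, f.2, by simpa using hf0, congrArg Subtype.val (LinearMap.mem_ker.mp hf)⟩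

/-- By surjectivity and rank-nullity the difference of dimensions is that of the kernel. -/
theorem weightCount_lt_of_hasSeminvariant {ℓ : ℕ} {m k : ℤ} (hk : 2 * k < ℓ * m)
    (h : HasSeminvariant ℓ m (k + 1)) : weightCount ℓ m k < weightCount ℓ m (k + 1) := by
  rw [← finrank_weightSpace, ← finrank_weightSpace]
  obtain ⟨f, hf, hf0, hDf⟩ := h
  have hs : LinearMap.range (loweringRestrict ℓ m k) = ⊤ := by
    rw [LinearMap.range_eq_top]
    rintro ⟨p, hp⟩
    obtain ⟨u, hu, hu'⟩ := exists_lowering_eq hk hp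
    exact ⟨⟨u, hu⟩, Subtype.ext hu'⟩
  have hker : 0 < Module.finrank ℚ (LinearMap.ker (loweringRestrict ℓ m k)) := by
    rw [pos_iff_ne_zero, Ne, Submodule.finrank_eq_zero, ← Ne, Submodule.ne_bot_iff]
    exact ⟨⟨f, hf⟩, LinearMap.mem_ker.mpr (Subtype.ext hDf), by simpa using hf0⟩
  have hr := LinearMap.finrank_range_add_finrank_ker (loweringRestrict ℓ m k)
  rw [hs, finrank_top] at hr
  omega

/-! ### Symmetry and recurrence of the monomial counts -/

theorem weightCount_of_neg {ℓ : ℕ} {m k : ℤ} (hk : k < 0) : weightCount ℓ m k = 0 := by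
  rw [← finrank_weightSpace, weightSpace_eq_bot hk, finrank_bot]

/-- Reversing the variables, i ↦ ℓ - i, is injective on monomials; applied twice it gives equality.
-/
theorem weightCount_le_weightCount_sub (ℓ : ℕ) (m k : ℤ) :
    weightCount ℓ m k ≤ weightCount ℓ m (ℓ * m - k) := by
  refine Set.ncard_le_ncard_of_injOn (Finsupp.equivMapDomain Fin.revPerm) (fun d hd => ?_)
    (Finsupp.equivCongrLeft Fin.revPerm).injective.injOn (finite_weight_biweight _ _ _)
  obtain ⟨h1, h2⟩ := (weight_biweight_eq_iff d).mp hd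
  refine (weight_biweight_eq_iff _).mpr ⟨?_, ?_⟩
  · rw [← h1]
    exact Equiv.sum_comp Fin.revPerm fun i => (d i : ℤ)
  · rw [← h1, ← h2, Finset.mul_sum, ← Finset.sum_sub_distrib, ← Equiv.sum_comp Fin.revPerm]
    refine Finset.sum_congr rfl fun i _ => ?_
    have : (i : ℕ) ≤ ℓ := Nat.le_of_lt_succ i.isLt
    simp [Finsupp.equivMapDomain_apply, Fin.val_rev]
    rw [Nat.cast_sub this]
    ring

theorem weightCount_sub (ℓ : ℕ) (m k : ℤ) :
    weightCount ℓ m (ℓ * m - k) = weightCount ℓ m k :=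
  le_antisymm (by simpa using weightCount_le_weightCount_sub ℓ m (ℓ * m - k))
    (weightCount_le_weightCount_sub ℓ m k)

theorem weightCount_zero_left (m : ℕ) (k : ℤ) : weightCount 0 m k = if k = 0 then 1 else 0 := by
  have h : {d : Fin (0 + 1) →₀ ℕ | Finsupp.weight (biweight 0) d = ((m : ℤ), k)} =
      if k = 0 then {Finsupp.single 0 m} else ∅ := by
    ext d
    rw [Set.mem_ofPred_eq, weight_biweight_eq_iff]
    split_ifs with hk
    · simp [hk, Finsupp.ext_iff]
    · simp [Ne.symm hk]
  rw [weightCount, h]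
  split_ifs <;> simp

theorem weightCount_zero_right (ℓ : ℕ) (k : ℤ) : weightCount ℓ 0 k = if k = 0 then 1 else 0 := by
  have h : {d : Fin (ℓ + 1) →₀ ℕ | Finsupp.weight (biweight ℓ) d = (0, k)} =
      if k = 0 then {0} else ∅ := by
    ext d
    rw [Set.mem_ofPred_eq, weight_biweight_eq_iff,
      Finset.sum_eq_zero_iff_of_nonneg fun _ _ => by positivity]
    have h0 : (∀ i ∈ Finset.univ, (d i : ℤ) = 0) ↔ d = 0 := by simp [Finsupp.ext_iff]
    rw [h0]
    split_ifs with hk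
    · simp +contextual [hk]
    · simp +contextual [Ne.symm hk]
  rw [weightCount, h]
  split_ifs <;> simp

/-- Monomials are split by whether the last variable occurs; if so, one factor of it is removed. -/
theorem weightCount_succ_succ (ℓ : ℕ) (m k : ℤ) :
    weightCount (ℓ + 1) (m + 1) k =
      weightCount ℓ (m + 1) k + weightCount (ℓ + 1) m (k - (ℓ + 1)) := by
  have hinj : Function.Injective (Finsupp.mapDomain (M := ℕ) (Fin.castSucc : Fin (ℓ + 1) → _)) :=
    Finsupp.mapDomain_injective (Fin.castSucc_injective _)
  have h0 (d : Fin (ℓ + 1) →₀ ℕ) : Finsupp.mapDomain Fin.castSucc d (Fin.last (ℓ + 1)) = 0 :=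
    Finsupp.mapDomain_of_notMem_range _ _ (by simp)
  have hw (d : Fin (ℓ + 1) →₀ ℕ) : Finsupp.weight (biweight (ℓ + 1))
      (Finsupp.mapDomain Fin.castSucc d) = Finsupp.weight (biweight ℓ) d := by
    rw [Finsupp.weight_eq_sum, Finsupp.weight_eq_sum, Fin.sum_univ_castSucc, h0]
    simp [Finsupp.mapDomain_apply (Fin.castSucc_injective _), biweight]
  have hs : {d : Fin (ℓ + 1 + 1) →₀ ℕ | Finsupp.weight (biweight (ℓ + 1)) d = (m + 1, k)} =
      Finsupp.mapDomain Fin.castSucc ''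
        {d : Fin (ℓ + 1) →₀ ℕ | Finsupp.weight (biweight ℓ) d = (m + 1, k)} ∪
      (· + Finsupp.single (Fin.last (ℓ + 1)) 1) ''
        {d : Fin (ℓ + 1 + 1) →₀ ℕ |
          Finsupp.weight (biweight (ℓ + 1)) d = (m, k - (ℓ + 1))} := by
    ext d
    constructor
    · intro hd
      by_cases hl : d (Fin.last (ℓ + 1)) = 0
      · left
        have e : Finsupp.mapDomain Fin.castSucc
            (d.comapDomain Fin.castSucc (Fin.castSucc_injective _).injOn) = d := by
          refine Finsupp.mapDomain_comapDomain _ (Fin.castSucc_injective _) _ fun i hi => ?_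
          refine Fin.lastCases (fun h => ?_) (fun j _ => ⟨j, rfl⟩) i hi
          exact absurd hl (Finsupp.mem_support_iff.mp h)
        exact ⟨_, by rw [Set.mem_ofPred_eq, ← hw, e]; exact hd, e⟩
      · right
        refine ⟨d - Finsupp.single (Fin.last (ℓ + 1)) 1, ?_, Finsupp.sub_add_single_one_cancel hl⟩
        have h := Finsupp.weight_sub_single_add (w := biweight (ℓ + 1)) hl
        rw [Set.mem_ofPred_eq] at hd ⊢
        rw [hd] at h
        rw [eq_sub_of_add_eq h]
        simp [biweight]
    · rintro (⟨d, hd, rfl⟩ | ⟨d, hd, rfl⟩)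
      · rw [Set.mem_ofPred_eq, hw]
        exact hd
      · rw [Set.mem_ofPred_eq] at hd
        rw [Set.mem_ofPred_eq, map_add, hd, Finsupp.weight_single]
        simp [biweight]
  rw [weightCount, hs, Set.ncard_union_eq _ ((finite_weight_biweight _ _ _).image _)
    ((finite_weight_biweight _ _ _).image _), Set.ncard_image_of_injective _ hinj,
    Set.ncard_image_of_injective _ (add_left_injective _)]
  · rfl
  · rw [Set.disjoint_left]
    rintro _ ⟨d, -, rfl⟩ ⟨e, -, he⟩
    have := DFunLike.congr_fun he (Fin.last (ℓ + 1))
    simp [h0] at this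

/-! ### Gaussian coefficients as monomial counts -/

theorem qBinomialDen_succ (ℓ : ℕ) :
    qBinomialDen (ℓ + 1) = qBinomialDen ℓ * (X ^ (ℓ + 1) - 1) := by
  simp [qBinomialDen, Finset.prod_Icc_succ_top]

theorem qBinomialDen_mul_qBinomialNum (ℓ m : ℕ) :
    qBinomialDen m * qBinomialNum ℓ m = qBinomialDen (m + ℓ) := by
  induction ℓ with
  | zero => simp [qBinomialNum]
  | succ ℓ ih =>
    rw [← add_assoc, qBinomialDen_succ, ← ih]
    simp [qBinomialNum, Finset.prod_Icc_succ_top, mul_assoc, add_assoc]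

theorem qBinomialDen_mul_qBinomialDen_mul_qBinomial (ℓ m : ℕ) :
    qBinomialDen m * (qBinomialDen ℓ * qBinomial ℓ m) = qBinomialDen (m + ℓ) := by
  rw [qBinomialDen_mul_qBinomial, qBinomialDen_mul_qBinomialNum]

theorem qBinomialDen_ne_zero (ℓ : ℕ) : qBinomialDen ℓ ≠ 0 := (qBinomialDen_monic ℓ).ne_zero

theorem qBinomial_comm (ℓ m : ℕ) : qBinomial ℓ m = qBinomial m ℓ := by
  refine mul_left_cancel₀ (qBinomialDen_ne_zero ℓ) (mul_left_cancel₀ (qBinomialDen_ne_zero m) ?_)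
  rw [qBinomialDen_mul_qBinomialDen_mul_qBinomial, mul_left_comm,
    qBinomialDen_mul_qBinomialDen_mul_qBinomial, add_comm]

theorem qBinomial_zero_left (m : ℕ) : qBinomial 0 m = 1 := by
  have h := qBinomialDen_mul_qBinomial 0 m
  simpa [qBinomialDen, qBinomialNum] using h

theorem qBinomial_zero_right (ℓ : ℕ) : qBinomial ℓ 0 = 1 := by
  rw [qBinomial_comm, qBinomial_zero_left]

theorem qBinomial_succ_succ (ℓ m : ℕ) :
    qBinomial (ℓ + 1) (m + 1) = qBinomial ℓ (m + 1) + X ^ (ℓ + 1) * qBinomial (ℓ + 1) m := by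
  refine mul_left_cancel₀ (qBinomialDen_ne_zero (ℓ + 1))
    (mul_left_cancel₀ (qBinomialDen_ne_zero (m + 1)) ?_)
  rw [qBinomialDen_mul_qBinomialDen_mul_qBinomial]
  have h1 := qBinomialDen_mul_qBinomialDen_mul_qBinomial ℓ (m + 1)
  have h2 := qBinomialDen_mul_qBinomialDen_mul_qBinomial (ℓ + 1) m
  have h3 := qBinomialDen_succ (m + ℓ + 1)
  have e1 : m + 1 + ℓ = m + ℓ + 1 := by ring
  have e2 : m + (ℓ + 1) = m + ℓ + 1 := by ring
  have e3 : m + 1 + (ℓ + 1) = m + ℓ + 1 + 1 := by ring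
  rw [e1] at h1
  rw [e2] at h2
  rw [e3, h3]
  -- With denominators cleared, the recurrence is X^(a+b) - 1 = (X^a - 1) + X^a (X^b - 1) for a = ℓ
  -- + 1, b = m + 1.
  calc qBinomialDen (m + ℓ + 1) * (X ^ (m + ℓ + 1 + 1) - 1)
      = (X ^ (ℓ + 1) - 1) * qBinomialDen (m + ℓ + 1) +
          X ^ (ℓ + 1) * (X ^ (m + 1) - 1) * qBinomialDen (m + ℓ + 1) := by ring
    _ = (X ^ (ℓ + 1) - 1) * (qBinomialDen (m + 1) * (qBinomialDen ℓ * qBinomial ℓ (m + 1))) +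
          X ^ (ℓ + 1) * (X ^ (m + 1) - 1) *
            (qBinomialDen m * (qBinomialDen (ℓ + 1) * qBinomial (ℓ + 1) m)) := by rw [h1, h2]
    _ = _ := by rw [qBinomialDen_succ ℓ, qBinomialDen_succ m]; ring

theorem qBinomialCoeff_comm (ℓ m n : ℕ) : qBinomialCoeff ℓ m n = qBinomialCoeff m ℓ n := by
  rw [qBinomialCoeff, qBinomial_comm, qBinomialCoeff]

theorem qBinomialCoeff_eq_weightCount (ℓ m n : ℕ) :
    qBinomialCoeff ℓ m n = weightCount ℓ m n := by
  induction ℓ generalizing m n with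
  | zero =>
    rw [qBinomialCoeff, qBinomial_zero_left, coeff_one, weightCount_zero_left]
    push_cast
    simp
  | succ ℓ ihℓ =>
    induction m generalizing n with
    | zero =>
      rw [qBinomialCoeff, qBinomial_zero_right, coeff_one, Nat.cast_zero, weightCount_zero_right]
      push_cast
      simp
    | succ m ihm =>
      rw [qBinomialCoeff, qBinomial_succ_succ, coeff_add, coeff_X_pow_mul', Nat.cast_succ m,
        weightCount_succ_succ, Nat.cast_add]
      congr 1
      · exact_mod_cast ihℓ (m + 1) n
      · split_ifs with h
        · rw [← qBinomialCoeff, ihm, Nat.cast_sub h]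
          push_cast
          rfl
        · rw [weightCount_of_neg (by omega), Nat.cast_zero]

theorem qBinomialCoeff_sub {ℓ m n : ℕ} (hn : n ≤ ℓ * m) :
    qBinomialCoeff ℓ m (ℓ * m - n) = qBinomialCoeff ℓ m n := by
  rw [qBinomialCoeff_eq_weightCount, qBinomialCoeff_eq_weightCount, Nat.cast_sub hn, Nat.cast_mul,
    weightCount_sub]

/-! ### Strict unimodality and its additivity -/

/-- The coefficients of the `q`-binomial coefficient increase strictly from `q` to the middle. -/
def IsStrictlyUnimodal (ℓ m : ℕ) : Prop :=
  ∀ n, 1 ≤ n → n + 1 ≤ ℓ * m / 2 → qBinomialCoeff ℓ m n < qBinomialCoeff ℓ m (n + 1)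

theorem IsStrictlyUnimodal.symm {ℓ m : ℕ} (h : IsStrictlyUnimodal ℓ m) :
    IsStrictlyUnimodal m ℓ := by
  intro n h1 h2
  rw [qBinomialCoeff_comm m, qBinomialCoeff_comm m]
  exact h n h1 (by rwa [mul_comm])

theorem isStrictlyUnimodal_iff_hasSeminvariant (ℓ m : ℕ) :
    IsStrictlyUnimodal ℓ m ↔ ∀ n : ℕ, 2 ≤ n → n ≤ ℓ * m / 2 → HasSeminvariant ℓ m n := by
  have key (n : ℕ) (hn : n + 1 ≤ ℓ * m / 2) :
      qBinomialCoeff ℓ m n < qBinomialCoeff ℓ m (n + 1) ↔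
        HasSeminvariant ℓ m ((n + 1 : ℕ) : ℤ) := by
    have h2 : 2 * (n : ℤ) < ℓ * m := by
      have : 2 * n < ℓ * m := by omega
      exact_mod_cast this
    rw [qBinomialCoeff_eq_weightCount, qBinomialCoeff_eq_weightCount, Nat.cast_lt, Nat.cast_succ n]
    exact ⟨hasSeminvariant_of_weightCount_lt, weightCount_lt_of_hasSeminvariant h2⟩
  constructor
  · intro h n h1 h2
    obtain ⟨n, rfl⟩ : ∃ k, n = k + 1 := ⟨n - 1, by omega⟩
    exact (key n h2).mp (h n (by omega) h2)
  · intro h n h1 h2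
    exact (key n h2).mpr (h _ (by omega) h2)

theorem IsStrictlyUnimodal.add {ℓ m m' : ℕ} (h : IsStrictlyUnimodal ℓ m)
    (h' : IsStrictlyUnimodal ℓ m') (heven : Even (ℓ * m)) (hm : 3 ≤ ℓ * m / 2)
    (hm' : 3 ≤ ℓ * m' / 2) : IsStrictlyUnimodal ℓ (m + m') := by
  rw [isStrictlyUnimodal_iff_hasSeminvariant] at *
  intro n h1 h2
  -- Evenness makes the two floors add up to the floor of the sum.
  have h3 : n ≤ ℓ * m / 2 + ℓ * m' / 2 := by
    rw [mul_add] at h2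
    obtain ⟨c, hc⟩ := heven
    omega
  -- Weight 1 is not supplied by the hypotheses, so neither summand may be 1; when n is one above
  -- the first bound, 2 is moved to the second summand.
  obtain ⟨a, b, rfl, ha, hb, ha', hb'⟩ : ∃ a b, a + b = n ∧ a ≤ ℓ * m / 2 ∧ b ≤ ℓ * m' / 2 ∧
      a ≠ 1 ∧ b ≠ 1 := by
    rcases le_or_gt n (ℓ * m / 2) with h4 | h4
    · exact ⟨n, 0, by omega, by omega, by omega, by omega, by omega⟩
    · rcases Nat.eq_or_lt_of_le h4 with h5 | h5
      · exact ⟨n - 2, 2, by omega, by omega, by omega, by omega, by omega⟩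
      · exact ⟨ℓ * m / 2, n - ℓ * m / 2, by omega, by omega, by omega, by omega, by omega⟩
  have hA : HasSeminvariant ℓ m a := by
    rcases Nat.eq_zero_or_pos a with rfl | h0
    · exact hasSeminvariant_zero ℓ m
    · exact h a (by omega) ha
  have hB : HasSeminvariant ℓ m' b := by
    rcases Nat.eq_zero_or_pos b with rfl | h0
    · exact hasSeminvariant_zero ℓ m'
    · exact h' b (by omega) hb
  exact_mod_cast hA.add hB

/-! ### Kernel computation of the small cases -/

/-- Coefficientwise sum of two lists. -/
def addCoeffs : List ℕ → List ℕ → List ℕ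
  | [], b => b
  | a, [] => a
  | x :: a, y :: b => (x + y) :: addCoeffs a b

/-- From the coefficient lists of `qBinomial ℓ j`, `qBinomial ℓ (j + 1)`, … and that of
`qBinomial (ℓ + 1) (j - 1)`, compute those of `qBinomial (ℓ + 1) j`, … -/
def nextRow (ℓ : ℕ) : List ℕ → List (List ℕ) → List (List ℕ)
  | _, [] => []
  | p, a :: r =>
    addCoeffs a (List.replicate (ℓ + 1) 0 ++ p) ::
      nextRow ℓ (addCoeffs a (List.replicate (ℓ + 1) 0 ++ p)) r

/-- The coefficient lists of `qBinomial ℓ 0`, …, `qBinomial ℓ (N - 1)`. -/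
def qBinomialRow (N : ℕ) : ℕ → List (List ℕ)
  | 0 => List.replicate N [1]
  | ℓ + 1 => nextRow ℓ [] (qBinomialRow N ℓ)

/-- Check that the entries of a list increase strictly for the first `n` steps. -/
def increasingFor : ℕ → List ℕ → Bool
  | 0, _ => true
  | n + 1, x :: y :: a => Nat.blt x y && increasingFor n (y :: a)
  | _ + 1, _ => false

theorem getD_addCoeffs (a b : List ℕ) (n : ℕ) :
    (addCoeffs a b).getD n 0 = a.getD n 0 + b.getD n 0 := by
  induction a generalizing b n with
  | nil => simp [addCoeffs]
  | cons x a ih =>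
    cases b with
    | nil => simp [addCoeffs]
    | cons y b =>
      cases n with
      | zero => simp [addCoeffs]
      | succ n => simpa [addCoeffs] using ih b n

theorem getD_replicate_append (k : ℕ) (p : List ℕ) (n : ℕ) :
    (List.replicate k 0 ++ p).getD n 0 = if k ≤ n then p.getD (n - k) 0 else 0 := by
  split_ifs with h
  · rw [List.getD_append_right _ _ _ _ (by simpa using h), List.length_replicate]
  · rw [List.getD_append _ _ _ _ (by simpa using h)]
    simp

/-- The list `a` holds the coefficients of `p`. -/
def IsCoeffList (a : List ℕ) (p : ℤ[X]) : Prop := ∀ n, p.coeff n = a.getD n 0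

theorem IsCoeffList.add_shift {a b : List ℕ} {p q : ℤ[X]} (ha : IsCoeffList a p)
    (hb : IsCoeffList b q) (k : ℕ) :
    IsCoeffList (addCoeffs a (List.replicate k 0 ++ b)) (p + X ^ k * q) := by
  intro n
  rw [getD_addCoeffs, getD_replicate_append, coeff_add, coeff_X_pow_mul', ha n, Nat.cast_add]
  congr 1
  split_ifs
  · exact hb _
  · rfl

theorem isCoeffList_nextRow (ℓ : ℕ) (r : List (List ℕ)) (j : ℕ) (p : List ℕ)
    (hp : IsCoeffList p (qBinomial (ℓ + 1) j))
    (hr : ∀ i (h : i < r.length), IsCoeffList r[i] (qBinomial ℓ (j + 1 + i))) :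
    ∀ i (h : i < (nextRow ℓ p r).length),
      IsCoeffList (nextRow ℓ p r)[i] (qBinomial (ℓ + 1) (j + 1 + i)) := by
  induction r generalizing j p with
  | nil => intro i h; simp [nextRow] at h
  | cons a r ih =>
    have h0 : IsCoeffList (addCoeffs a (List.replicate (ℓ + 1) 0 ++ p))
        (qBinomial (ℓ + 1) (j + 1)) := by
      rw [qBinomial_succ_succ]
      exact (hr 0 (by simp)).add_shift hp _
    intro i h
    cases i with
    | zero => exact h0
    | succ i =>
      have := ih (j + 1) _ h0 (fun i hi => by
        have := hr (i + 1) (by simpa using hi)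
        rwa [show j + 1 + 1 + i = j + 1 + (i + 1) by ring]) i (by simpa [nextRow] using h)
      rwa [show j + 1 + (i + 1) = j + 1 + 1 + i by ring]

theorem isCoeffList_qBinomialRow (N ℓ i : ℕ) (h : i < (qBinomialRow N ℓ).length) :
    IsCoeffList (qBinomialRow N ℓ)[i] (qBinomial ℓ i) := by
  have one (n : ℕ) : (1 : ℤ[X]).coeff n = (([1] : List ℕ).getD n 0 : ℕ) := by
    cases n <;> simp [coeff_one]
  induction ℓ generalizing i with
  | zero =>
    intro n
    simp only [qBinomialRow, List.getElem_replicate, qBinomial_zero_left, one]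
  | succ ℓ ih =>
    generalize hR : qBinomialRow N (ℓ + 1) = R at h ⊢
    rw [qBinomialRow] at hR
    generalize qBinomialRow N ℓ = r at hR ih
    subst hR
    cases r with
    | nil => simp [nextRow] at h
    | cons a r =>
      -- The recurrence starts from the empty list, standing for the zero polynomial.
      have h0 : IsCoeffList (addCoeffs a (List.replicate (ℓ + 1) 0 ++ []))
          (qBinomial (ℓ + 1) 0) := by
        have ha : IsCoeffList a (qBinomial ℓ 0) := ih 0 (by simp)
        have h1 := ha.add_shift (b := []) (q := 0) (fun n => by simp) (ℓ + 1)
        rwa [mul_zero, add_zero, qBinomial_zero_right, ← qBinomial_zero_right (ℓ + 1)] at h1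
      cases i with
      | zero => exact h0
      | succ i =>
        have := isCoeffList_nextRow ℓ r 0 _ h0 (fun i hi => by
          have := ih (i + 1) (by simpa using hi)
          rwa [show 0 + 1 + i = i + 1 by ring]) i (by simpa [nextRow] using h)
        rwa [show 0 + 1 + i = i + 1 by ring] at this

theorem getD_lt_of_increasingFor {k : ℕ} {a : List ℕ} (h : increasingFor k a) {n : ℕ}
    (hn : n < k) : a.getD n 0 < a.getD (n + 1) 0 := by
  induction k generalizing a n with
  | zero => omega
  | succ k ih =>
    match a, h with
    | x :: y :: a, h =>
      simp only [increasingFor, Bool.and_eq_true, Nat.blt_eq] at h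
      cases n with
      | zero => simpa using h.1
      | succ n => simpa using ih h.2 (n := n) (by omega)

/-- Decidable check of strict unimodality for all `ℓ` and `m` between `8` and `15`. -/
def smallCasesCheck : Bool :=
  (List.range 8).all fun a =>
    let r := qBinomialRow 16 (a + 8)
    (List.range 8).all fun b =>
      match r[b + 8]? with
      -- The tail drops the constant coefficient: the increase starts at index 1.
      | some c => increasingFor ((a + 8) * (b + 8) / 2 - 1) c.tail
      | none => false

theorem smallCasesCheck_eq_true : smallCasesCheck = true := by decide +kernel

theorem isStrictlyUnimodal_of_lt_sixteen {ℓ m : ℕ} (hℓ : 8 ≤ ℓ) (hm : 8 ≤ m) (hℓ' : ℓ < 16)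
    (hm' : m < 16) : IsStrictlyUnimodal ℓ m := by
  have h := smallCasesCheck_eq_true
  simp only [smallCasesCheck, List.all_eq_true, List.mem_range] at h
  have h := h (ℓ - 8) (by omega) (m - 8) (by omega)
  rw [Nat.sub_add_cancel hℓ, Nat.sub_add_cancel hm] at h
  split at h
  · rename_i c hc
    obtain ⟨hi, rfl⟩ := List.getElem?_eq_some_iff.mp hc
    have hcoeff := isCoeffList_qBinomialRow 16 ℓ m hi
    intro n h1 h2
    have h3 := getD_lt_of_increasingFor h (n := n - 1) (by omega)
    rw [qBinomialCoeff, qBinomialCoeff, hcoeff n, hcoeff (n + 1)]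
    obtain ⟨n, rfl⟩ : ∃ k, n = k + 1 := ⟨n - 1, by omega⟩
    rw [Nat.add_sub_cancel] at h3
    simp only [List.getD_eq_getElem?_getD, List.getElem?_tail] at h3 ⊢
    exact_mod_cast h3
  · simp at h

/-! ### Induction in steps of 8 and the conclusion -/

theorem IsStrictlyUnimodal.of_lt_sixteen {ℓ : ℕ} (hℓ : 8 ≤ ℓ)
    (h : ∀ m, 8 ≤ m → m < 16 → IsStrictlyUnimodal ℓ m) (m : ℕ) (hm : 8 ≤ m) :
    IsStrictlyUnimodal ℓ m := by
  induction m using Nat.strong_induction_on with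
  | _ m ih =>
    rcases lt_or_ge m 16 with h16 | h16
    · exact h m hm h16
    · have h1 := ih (m - 8) (by omega) (by omega)
      have h2 := (h 8 le_rfl (by norm_num)).add h1 (Even.mul_left (by decide) _) (by omega) (by
        have := Nat.mul_le_mul hℓ (show 8 ≤ m - 8 by omega)
        omega)
      rwa [Nat.add_sub_cancel' hm] at h2

/-- The induction is run twice: once in each variable, exchanged by symmetry. -/
theorem isStrictlyUnimodal {ℓ m : ℕ} (hℓ : 8 ≤ ℓ) (hm : 8 ≤ m) : IsStrictlyUnimodal ℓ m :=
  IsStrictlyUnimodal.of_lt_sixteen hℓ (fun _ hk hk' =>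
    (IsStrictlyUnimodal.of_lt_sixteen hk (fun _ hj hj' =>
      isStrictlyUnimodal_of_lt_sixteen hk hj hk' hj') ℓ hℓ).symm) m hm

theorem floor_natCast_mul_div_two (ℓ m : ℕ) : ⌊(ℓ * m : ℚ) / 2⌋₊ = ℓ * m / 2 := by
  have h := Nat.floor_div_eq_div (K := ℚ) (ℓ * m) 2
  push_cast at h
  exact h

theorem ceil_natCast_mul_div_two (ℓ m : ℕ) : ⌈(ℓ * m : ℚ) / 2⌉₊ = ℓ * m - ℓ * m / 2 := by
  rw [← Nat.cast_mul]
  refine le_antisymm (Nat.ceil_le.mpr ?_) ?_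
  · rw [div_le_iff₀ (by norm_num)]
    exact_mod_cast (by omega : ℓ * m ≤ (ℓ * m - ℓ * m / 2) * 2)
  · have h := Nat.le_ceil (((ℓ * m : ℕ) : ℚ) / 2)
    rw [div_le_iff₀ (by norm_num)] at h
    have h' : ℓ * m ≤ ⌈((ℓ * m : ℕ) : ℚ) / 2⌉₊ * 2 := by exact_mod_cast h
    omega

theorem theoremt (ℓ m : ℕ) (hℓ : 8 ≤ ℓ) (hm : 8 ≤ m) :
    (∀ n : ℕ, 1 ≤ n → n + 1 ≤ ⌊(ℓ * m : ℚ) / 2⌋₊ →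
      qBinomialCoeff ℓ m n < qBinomialCoeff ℓ m (n + 1)) ∧
    qBinomialCoeff ℓ m ⌊(ℓ * m : ℚ) / 2⌋₊ = qBinomialCoeff ℓ m ⌈(ℓ * m : ℚ) / 2⌉₊ ∧
    (∀ n : ℕ, ⌈(ℓ * m : ℚ) / 2⌉₊ ≤ n → n + 1 ≤ ℓ * m - 1 →
      qBinomialCoeff ℓ m n > qBinomialCoeff ℓ m (n + 1)) := by
  rw [floor_natCast_mul_div_two, ceil_natCast_mul_div_two]
  refine ⟨isStrictlyUnimodal hℓ hm, (qBinomialCoeff_sub (Nat.div_le_self _ _)).symm, ?_⟩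
  intro n h1 h2
  -- The decreasing half is the reflection n ↦ ℓm - n of the increasing half.
  have h := isStrictlyUnimodal hℓ hm (ℓ * m - (n + 1)) (by omega) (by omega)
  rwa [show ℓ * m - (n + 1) + 1 = ℓ * m - n by omega, qBinomialCoeff_sub (by omega),
    qBinomialCoeff_sub (by omega)] at h
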